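/- For $n\ge 0$ let $\Delta_n=\sum_{k=0}^{n}\bigl(k-\langle n_+\rangle\bigr)^2p(k,n)$, with $\langle n_+\rangle=\sum_{k=0}^n k\,p(k,n)$, be the variance of the index (the number $n_+$ of positive eigenvalues) of the $n\times n$ Gaussian unitary ensemble. Here $p(k,n)$ is the probability that exactly $k$ of $\lambda_1,\dots,\lambda_n$ are positive under the eigenvalue density $$\frac1{N_n}\,e^{-\sum_{j}\lambda_j^2}\prod_{1\le j<k\le n}(\lambda_j-\lambda_k)^2\quad\text{on }\mathbb R^n,$$ where $N_n$ is the normalisation constant. Put $\tau_0(\xi)=1$ and, for $n\ge1$, $$\tau_n(\xi)=2^{n(n-1)}\det\Bigl[\int_{-\infty}^0(-x)^{i+j}e^{-x^2}dx+\xi\int_0^\infty(-x)^{i+j}e^{-x^2}dx\Bigr]_{0\le i,j\le n-1}.$$ Let $g_0(\xi)=0$, let $g_n(\xi)=\tau_{n+1}(\xi)\tau_{n-1}(\xi)/\tau_n(\xi)^2-2n$ for $n\ge1$, and let $e_{2m+1}=\tfrac12g_{2m}''(1)+\tfrac12g_{2m+1}''(1)$ for $m\ge 0$. Then $D_n=\Delta_n$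 $(n\ge0)$ is the unique real sequence with $D_0=0$, $D_1=\tfrac14$, $D_2=\tfrac12-\tfrac1\pi$ and $$nD_{n+1}-(n+1)D_n-(n-2)D_{n-1}+(n-1)D_{n-2}=\frac{1-(-1)^n}{2}\,e_n,\qquad n\ge2$$ (for even $n$ the right-hand side is $0$), and it is given by $$\Delta_n=\frac n4+n\sum_{j=1}^{n-1}\frac{1}{j(j+1)}\,\frac{1-(-1)^j}{2}\Bigl(\sum_{l=1}^{(j-1)/2}e_{2l+1}-\frac1\pi\Bigr),\qquad n\ge0$$ (for even $j$ the summand is $0$). -/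

import Mathlib

noncomputable section

namespace GUEIndex

/-- The unnormalised joint density of the eigenvalues of the `n × n` Gaussian unitary ensemble,
`exp (-∑ λ_j²) ∏_{j<k} (λ_j - λ_k)²`. -/
def weight (n : ℕ) (l : Fin n → ℝ) : ℝ :=
  Real.exp (-∑ j, l j ^ 2) * ∏ j, ∏ k ∈ Finset.Ioi j, (l j - l k) ^ 2

/-- The normalisation constant of the eigenvalue density. -/
def normalisation (n : ℕ) : ℝ := ∫ l : Fin n → ℝ, weight n l

/-- The number of positive entries of `l` (the index, when `l` lists the eigenvalues). -/
def index {n : ℕ} (l : Fin n → ℝ) : ℕ := (Finset.univ.filter fun j => 0 < l j).card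

/-- The probability that exactly `k` of the `n` eigenvalues are positive. -/
def prob (n k : ℕ) : ℝ :=
  (∫ l in {l : Fin n → ℝ | index l = k}, weight n l) / normalisation n

/-- The mean of the index. -/
def mean (n : ℕ) : ℝ := ∑ k ∈ Finset.range (n + 1), (k : ℝ) * prob n k

/-- The variance of the index, `Δ_n`. -/
def Delta (n : ℕ) : ℝ := ∑ k ∈ Finset.range (n + 1), ((k : ℝ) - mean n) ^ 2 * prob n k

/-- The Hankel determinant `τ_n(ξ)`, with `τ_0 = 1`. -/
def tau (n : ℕ) (ξ : ℝ) : ℝ :=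
  2 ^ (n * (n - 1)) * Matrix.det (Matrix.of fun i j : Fin n =>
    (∫ x in Set.Iio (0 : ℝ), (-x) ^ (i.val + j.val) * Real.exp (-x ^ 2))
      + ξ * ∫ x in Set.Ioi (0 : ℝ), (-x) ^ (i.val + j.val) * Real.exp (-x ^ 2))

/-- `g_0 = 0` and `g_n = τ_{n+1} τ_{n-1} / τ_n² - 2 n` for `n ≥ 1`. -/
def g : ℕ → ℝ → ℝ
  | 0, _ => 0
  | n + 1, ξ => tau (n + 2) ξ * tau n ξ / tau (n + 1) ξ ^ 2 - 2 * ((n : ℝ) + 1)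

/-- The inhomogeneous term `e_n = (g_{n-1}''(1) + g_n''(1)) / 2`; only odd `n` are used, since
`e_n` always comes with the factor `(1 - (-1)^n) / 2` or with an odd subscript. -/
def e (n : ℕ) : ℝ := iteratedDeriv 2 (g (n - 1)) 1 / 2 + iteratedDeriv 2 (g n) 1 / 2

/-- `D` solves the third order difference equation of the variance of the index, with the
initial values `0`, `1/4` and `1/2 - 1/π`. -/
def IsSolution (D : ℕ → ℝ) : Prop :=
  D 0 = 0 ∧ D 1 = 1 / 4 ∧ D 2 = 1 / 2 - 1 / Real.pi ∧
  ∀ n : ℕ, 2 ≤ n →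
    (n : ℝ) * D (n + 1) - ((n : ℝ) + 1) * D n - ((n : ℝ) - 2) * D (n - 1)
      + ((n : ℝ) - 1) * D (n - 2) = (1 - (-1) ^ n) / 2 * e n

/-- The right-hand side of the quadrature formula. For even `j` the factor `(1 - (-1)^j) / 2`
vanishes, so the division `(j - 1) / 2` matters only for odd `j`, where it is exact. -/
def quadrature (n : ℕ) : ℝ :=
  (n : ℝ) / 4 + n * ∑ j ∈ Finset.Icc 1 (n - 1),
    1 / ((j : ℝ) * ((j : ℝ) + 1)) * ((1 - (-1) ^ j) / 2)
      * ((∑ l ∈ Finset.Icc 1 ((j - 1) / 2), e (2 * l + 1)) - 1 / Real.pi)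

end GUEIndex

end

noncomputable section

open MeasureTheory Filter Topology Polynomial

namespace GUEIndex

/-! By Andréief's identity the generating function of the index is `indexGen n ξ`
$=\det(1+(\xi-1)A_n)$, where $A_n$ is the compression to the first $n$ Hermite functions of the
projection onto $(0,\infty)$. Its second-order jet at $\xi=1$ involves only
$\operatorname{tr}A_n=n/2$ and $\operatorname{tr}A_n^2$, so $\Delta_n=n/2-\operatorname{tr}A_n^2$
(`Delta_eq`), and the increments of $\Delta$ are governed by the column sums of squared entries of
$A_n$.

Up to a constant $\tau_n$ is the same generating function, so
$g_n''(1)=2n(\Delta_{n+1}-2\Delta_n+\Delta_{n-1})$ (`iteratedDeriv_g`). The difference equation for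
odd $n$ is then an identity. For even $n$ it is a relation between column sums
(`columnSum_recurrence`), which follows from closed forms of the entries as Wronskians at $0$.

The left side of the equation is $E_n-E_{n-2}$ with $E_n=nD_{n+1}-(n+1)D_n$. Summing once gives
$E_n$; dividing by $n(n+1)$ and summing again gives the quadrature formula for every solution, hence
uniqueness. -/

/-- `f` is differentiable near `x`, twice differentiable at `x`, and has there the value `a`, the
derivative `b` and the second derivative `c`. -/
def HasJet (f : ℝ → ℝ) (x a b c : ℝ) : Prop :=
  ∃ f' : ℝ → ℝ, (∀ᶠ y in 𝓝 x, HasDerivAt f (f' y) y) ∧ f x = a ∧ f' x = b ∧ HasDerivAt f' c x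

/-! ### Arithmetic of second-order jets. -/

namespace HasJet

variable {f h : ℝ → ℝ} {x a b c a' b' c' : ℝ}

theorem deriv_deriv_eq (H : HasJet f x a b c) : f x = a ∧ deriv f x = b ∧ deriv (deriv f) x = c := by
  obtain ⟨f', h1, h2, h3, h4⟩ := H
  have e : deriv f =ᶠ[𝓝 x] f' := h1.mono fun y hy => hy.deriv
  exact ⟨h2, h3 ▸ h1.self_of_nhds.deriv, by rw [e.deriv_eq, h4.deriv]⟩

theorem iteratedDeriv_two (H : HasJet f x a b c) : iteratedDeriv 2 f x = c := by
  rw [iteratedDeriv_succ, iteratedDeriv_one]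
  exact H.deriv_deriv_eq.2.2

theorem unique (H : HasJet f x a b c) (H' : HasJet f x a' b' c') : a = a' ∧ b = b' ∧ c = c' := by
  obtain ⟨h1, h2, h3⟩ := H.deriv_deriv_eq
  obtain ⟨h1', h2', h3'⟩ := H'.deriv_deriv_eq
  exact ⟨h1 ▸ h1', h2 ▸ h2', h3 ▸ h3'⟩

theorem const (x a : ℝ) : HasJet (fun _ => a) x a 0 0 :=
  ⟨fun _ => 0, .of_forall fun y => hasDerivAt_const y a, rfl, rfl, hasDerivAt_const x 0⟩

theorem id (x : ℝ) : HasJet (fun y => y) x x 1 0 :=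
  ⟨fun _ => 1, .of_forall fun y => hasDerivAt_id y, rfl, rfl, hasDerivAt_const x 1⟩

theorem add (H : HasJet f x a b c) (H' : HasJet h x a' b' c') :
    HasJet (fun y => f y + h y) x (a + a') (b + b') (c + c') := by
  obtain ⟨f', h1, rfl, rfl, h4⟩ := H
  obtain ⟨h', k1, rfl, rfl, k4⟩ := H'
  exact ⟨fun y => f' y + h' y, by filter_upwards [h1, k1] with y hy ky using hy.add ky, rfl, rfl,
    h4.add k4⟩

theorem mul (H : HasJet f x a b c) (H' : HasJet h x a' b' c') :
    HasJet (fun y => f y * h y) x (a * a') (b * a' + a * b')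
      (c * a' + 2 * (b * b') + a * c') := by
  obtain ⟨f', h1, rfl, rfl, h4⟩ := H
  obtain ⟨h', k1, rfl, rfl, k4⟩ := H'
  refine ⟨fun y => f' y * h y + f y * h' y, ?_, rfl, rfl, ?_⟩
  · filter_upwards [h1, k1] with y hy ky using hy.mul ky
  · refine ((h4.mul k1.self_of_nhds).add (h1.self_of_nhds.mul k4)).congr_deriv ?_
    ring

theorem inv (H : HasJet f x a b c) (ha : a ≠ 0) :
    HasJet (fun y => (f y)⁻¹) x a⁻¹ (-b / a ^ 2) (-c / a ^ 2 + 2 * b ^ 2 / a ^ 3) := by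
  obtain ⟨f', h1, rfl, rfl, h4⟩ := H
  have hf := h1.self_of_nhds
  refine ⟨fun y => -f' y / f y ^ 2, ?_, rfl, rfl, ?_⟩
  · filter_upwards [h1, hf.continuousAt.eventually_ne ha] with y hy ky using hy.inv ky
  · refine (h4.neg.div (hf.pow 2) (pow_ne_zero 2 ha)).congr_deriv ?_
    simp only [Pi.neg_apply, Pi.pow_apply]
    field_simp
    ring

theorem congr_jet (H : HasJet f x a b c) (ha : a = a') (hb : b = b') (hc : c = c') :
    HasJet f x a' b' c' := by
  subst ha hb hc; exact H

theorem pow_at_one (k : ℕ) : HasJet (fun y => y ^ k) 1 1 k (k * (k - 1)) := by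
  induction k with
  | zero => simpa using const 1 1
  | succ k ih =>
    simp only [pow_succ]
    exact (ih.mul (id 1)).congr_jet (by simp) (by simp) (by push_cast; ring)

theorem sum {ι : Type*} (s : Finset ι) {F : ι → ℝ → ℝ} {A B C : ι → ℝ}
    (H : ∀ i ∈ s, HasJet (F i) x (A i) (B i) (C i)) :
    HasJet (fun y => ∑ i ∈ s, F i y) x (∑ i ∈ s, A i) (∑ i ∈ s, B i) (∑ i ∈ s, C i) := by
  classical
  induction s using Finset.induction_on with
  | empty => simpa using const x 0
  | insert i s hi ih =>
    simp only [Finset.sum_insert hi]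
    exact (H i (by simp)).add (ih fun j hj => H j (by simp [hj]))

/-- The second derivative is twice the second elementary symmetric function of the $r_i$, rewritten
through power sums. -/
theorem prod_one_add {ι : Type*} (s : Finset ι) (r : ι → ℝ) :
    HasJet (fun y => ∏ i ∈ s, (1 + (y - 1) * r i)) 1 1 (∑ i ∈ s, r i)
      ((∑ i ∈ s, r i) ^ 2 - ∑ i ∈ s, r i ^ 2) := by
  classical
  induction s using Finset.induction_on with
  | empty => simpa using const 1 1
  | insert i s hi ih =>
    have h1 : HasJet (fun y => 1 + (y - 1) * r i) 1 1 (r i) 0 := by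
      have := (const 1 1).add (((id 1).add (const 1 (-1))).mul (const 1 (r i)))
      simpa [← sub_eq_add_neg] using this
    simp only [Finset.prod_insert hi, Finset.sum_insert hi]
    exact (h1.mul ih).congr_jet (by ring) (by ring) (by ring)

end HasJet

/-! ### Determinants: jets at the identity and integrals of squares. -/

theorem det_one_add_smul_hasJet {n : ℕ} (A : Matrix (Fin n) (Fin n) ℝ) (hA : A.IsHermitian) :
    HasJet (fun y => (1 + (y - 1) • A).det) 1 1 A.trace (A.trace ^ 2 - (A * A).trace) := by
  set U := (hA.eigenvectorUnitary : Matrix (Fin n) (Fin n) ℝ)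
  set D := Matrix.diagonal hA.eigenvalues with hD
  have hUU : star U * U = 1 := Unitary.coe_star_mul_self hA.eigenvectorUnitary
  have hUU' : U * star U = 1 := Unitary.coe_mul_star_self hA.eigenvectorUnitary
  have hs : A = U * D * star U := by
    conv_lhs => rw [hA.spectral_theorem, Unitary.conjStarAlgAut_apply]
    rfl
  have hdet : ∀ y : ℝ, (1 + (y - 1) • A).det = ∏ i, (1 + (y - 1) * hA.eigenvalues i) := by
    intro y
    have : 1 + (y - 1) • A = U * (1 + (y - 1) • D) * star U := by
      rw [mul_add, add_mul, mul_one, hUU']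
      conv_lhs => rw [hs]
      simp
    rw [this, Matrix.det_mul_right_comm, hUU', one_mul]
    have : 1 + (y - 1) • D = Matrix.diagonal fun i => 1 + (y - 1) * hA.eigenvalues i := by
      ext i j
      by_cases h : i = j <;> simp [hD, h, Matrix.diagonal]
    rw [this, Matrix.det_diagonal]
  have ht : A.trace = ∑ i, hA.eigenvalues i := by simpa using hA.trace_eq_sum_eigenvalues
  have ht2 : (A * A).trace = ∑ i, hA.eigenvalues i ^ 2 := by
    have : A * A = U * (D * D) * star U := by
      conv_lhs => rw [hs]
      calc U * D * star U * (U * D * star U) = U * D * (star U * U) * D * star U := by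
            simp only [mul_assoc]
        _ = _ := by rw [hUU]; simp only [mul_assoc, mul_one]
    rw [this, Matrix.trace_mul_comm, ← mul_assoc, hUU, one_mul, hD, Matrix.diagonal_mul_diagonal,
      Matrix.trace_diagonal]
    simp [sq]
  simp only [hdet, ht, ht2]
  exact HasJet.prod_one_add _ _

/-- **Andréief's identity** for a single family of functions. -/
theorem integral_prod_mul_det_sq {n : ℕ} (w : ℝ → ℝ) (f : Fin n → ℝ → ℝ)
    (hf : ∀ i j, Integrable fun x => w x * (f i x * f j x)) :
    Integrable (fun l : Fin n → ℝ =>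
      (∏ i, w (l i)) * (Matrix.of fun i j => f j (l i)).det ^ 2) ∧
    ∫ l : Fin n → ℝ, (∏ i, w (l i)) * (Matrix.of fun i j => f j (l i)).det ^ 2
      = n.factorial * (Matrix.of fun i j => ∫ x, w x * (f i x * f j x)).det := by
  have hexp : ∀ l : Fin n → ℝ, (∏ i, w (l i)) * (Matrix.of fun i j => f j (l i)).det ^ 2
      = ∑ σ : Equiv.Perm (Fin n), ∑ τ : Equiv.Perm (Fin n),
        (((Equiv.Perm.sign σ : ℤ) : ℝ) * ((Equiv.Perm.sign τ : ℤ) : ℝ)) *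
          ∏ i, w (l i) * (f (σ i) (l i) * f (τ i) (l i)) := by
    intro l
    rw [← Matrix.det_transpose, Matrix.det_apply', sq, Finset.sum_mul_sum, Finset.mul_sum]
    refine Finset.sum_congr rfl fun σ _ => ?_
    rw [Finset.mul_sum]
    refine Finset.sum_congr rfl fun τ _ => ?_
    simp only [Finset.prod_mul_distrib, Matrix.transpose_apply, Matrix.of_apply]
    ring
  have hint : ∀ σ τ : Equiv.Perm (Fin n), Integrable (fun l : Fin n → ℝ =>
      (((Equiv.Perm.sign σ : ℤ) : ℝ) * ((Equiv.Perm.sign τ : ℤ) : ℝ)) *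
          ∏ i, w (l i) * (f (σ i) (l i) * f (τ i) (l i))) := fun σ τ =>
    (Integrable.fintype_prod (f := fun i x => w x * (f (σ i) x * f (τ i) x))
      fun i => hf (σ i) (τ i)).const_mul _
  simp only [hexp]
  refine ⟨integrable_finsetSum _ fun σ _ => integrable_finsetSum _ fun τ _ => hint σ τ, ?_⟩
  rw [integral_finsetSum _ fun σ _ => integrable_finsetSum _ fun τ _ => hint σ τ]
  set M : Matrix (Fin n) (Fin n) ℝ := Matrix.of fun i j => ∫ x, w x * (f i x * f j x) with hM
  -- For fixed $\sigma$ the sum over $\tau$ is the determinant of $M$ with rows permuted by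
  -- $\sigma$. The sign of $\sigma$ undoes the permutation, so each of the $n!$ terms equals $\det
  -- M$.
  have key : ∀ σ : Equiv.Perm (Fin n), ∫ l : Fin n → ℝ, ∑ τ : Equiv.Perm (Fin n),
        (((Equiv.Perm.sign σ : ℤ) : ℝ) * ((Equiv.Perm.sign τ : ℤ) : ℝ)) *
          ∏ i, w (l i) * (f (σ i) (l i) * f (τ i) (l i)) = M.det := by
    intro σ
    rw [integral_finsetSum _ fun τ _ => hint σ τ]
    have hsq : (((Equiv.Perm.sign σ : ℤ) : ℝ) * ((Equiv.Perm.sign σ : ℤ) : ℝ)) = 1 := by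
      norm_cast
      simp
    have h2 := Matrix.det_permute σ M
    have h3 : M.det = ((Equiv.Perm.sign σ : ℤ) : ℝ) * (M.submatrix σ _root_.id).det := by
      rw [h2, ← mul_assoc, hsq, one_mul]
    rw [h3, ← Matrix.det_transpose, Matrix.det_apply', Finset.mul_sum]
    refine Finset.sum_congr rfl fun τ _ => ?_
    rw [integral_const_mul, integral_fintype_prod_volume_eq_prod
      (fun i x => w x * (f (σ i) x * f (τ i) x)), mul_assoc]
    simp [hM]
  simp only [key]
  simp [Fintype.card_perm]

/-! ### Hermite polynomials and integration by parts. -/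

/-- The monic orthogonal polynomials of the weight `exp (-x²)`. -/
def monicHermite : ℕ → ℝ[X]
  | 0 => 1
  | n + 1 => X * monicHermite n - C (1 / 2) * derivative (monicHermite n)

theorem derivative_monicHermite_succ (n : ℕ) :
    derivative (monicHermite (n + 1)) = C (n + 1 : ℝ) * monicHermite n := by
  induction n with
  | zero => simp [monicHermite]
  | succ n ih =>
    rw [monicHermite, derivative_sub, derivative_mul, derivative_C_mul, ih, derivative_C_mul,
      derivative_X]
    conv_rhs => rw [monicHermite]
    conv_lhs => rw [monicHermite]
    simp only [map_add, map_one, Nat.cast_succ]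
    ring

theorem monicHermite_ode (n : ℕ) :
    derivative (derivative (monicHermite n)) =
      2 * X * derivative (monicHermite n) - C (2 * n : ℝ) * monicHermite n := by
  have h := derivative_monicHermite_succ n
  rw [monicHermite, derivative_sub, derivative_mul, derivative_C_mul, derivative_X] at h
  have h2 : (2 : ℝ[X]) * C (1 / 2) = 1 := by
    rw [← C_ofNat, ← C_mul]; norm_num
  have h3 := congrArg (fun p => (2 : ℝ[X]) * p) h
  simp only [map_add, map_one, map_mul, C_ofNat] at h3 ⊢
  linear_combination (-1 : ℝ[X]) * h3 - derivative (derivative (monicHermite n)) * h2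

theorem monicHermite_comp_neg (n : ℕ) :
    (monicHermite n).comp (-X) = (-1) ^ n * monicHermite n := by
  induction n with
  | zero => simp [monicHermite]
  | succ n ih =>
    have h := congrArg derivative ih
    rw [derivative_comp, ← C_1, ← C_neg, ← C_pow, derivative_C_mul] at h
    simp only [derivative_neg, derivative_X] at h
    simp only [monicHermite, sub_comp, mul_comp, X_comp, C_comp, ih, pow_succ]
    simp only [C_neg, C_pow, C_1] at h
    linear_combination C (1 / 2 : ℝ) * h

theorem monicHermite_natDegree_monic (n : ℕ) :
    (monicHermite n).natDegree = n ∧ (monicHermite n).Monic := by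
  induction n with
  | zero => simp [monicHermite]
  | succ n ih =>
    obtain ⟨h1, h2⟩ := ih
    have hd : (X * monicHermite n).natDegree = n + 1 := by
      rw [natDegree_X_mul h2.ne_zero, h1]
    have hm : (X * monicHermite n).Monic := monic_X.mul h2
    have hlt : (C (1 / 2) * derivative (monicHermite n)).natDegree < (X * monicHermite n).natDegree := by
      rw [hd]
      have := natDegree_C_mul_le (1 / 2 : ℝ) (derivative (monicHermite n))
      have := natDegree_derivative_le (monicHermite n)
      omega
    refine ⟨by rw [monicHermite, natDegree_sub_eq_left_of_natDegree_lt hlt, hd], ?_⟩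
    exact hm.sub_of_left (degree_lt_degree hlt)

theorem integrable_eval_mul_exp (p : ℝ[X]) :
    Integrable fun x : ℝ => p.eval x * Real.exp (-x ^ 2) := by
  induction p using Polynomial.induction_on' with
  | add p q hp hq =>
    simp only [eval_add, add_mul]
    exact hp.add hq
  | monomial n a =>
    have h := integrable_rpow_mul_exp_neg_mul_sq (b := 1) one_pos (s := n)
      (by have : (0 : ℝ) ≤ n := n.cast_nonneg
          linarith)
    simpa [mul_assoc] using h.const_mul a

theorem hasDerivAt_eval_mul_exp (p : ℝ[X]) (x : ℝ) :
    HasDerivAt (fun x : ℝ => p.eval x * Real.exp (-x ^ 2))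
      ((derivative p - 2 * X * p).eval x * Real.exp (-x ^ 2)) x := by
  have h1 : HasDerivAt (fun x : ℝ => -x ^ 2) (-(2 * x)) x :=
    (hasDerivAt_pow 2 x).neg.congr_deriv (by simp)
  refine ((p.hasDerivAt x).mul h1.exp).congr_deriv ?_
  simp only [eval_sub, eval_mul, eval_X, eval_ofNat]
  ring

theorem integral_eval_deriv (p : ℝ[X]) :
    ∫ x : ℝ, (derivative p - 2 * X * p).eval x * Real.exp (-x ^ 2) = 0 :=
  integral_eq_zero_of_hasDerivAt_of_integrable (hasDerivAt_eval_mul_exp p)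
    (integrable_eval_mul_exp _) (integrable_eval_mul_exp _)

theorem integral_Ioi_eval_deriv (p : ℝ[X]) :
    ∫ x in Set.Ioi (0 : ℝ), (derivative p - 2 * X * p).eval x * Real.exp (-x ^ 2)
      = -p.eval 0 := by
  have hi := (integrable_eval_mul_exp (derivative p - 2 * X * p)).integrableOn (s := Set.Ioi (0 : ℝ))
  have h := integral_Ioi_of_hasDerivAt_of_tendsto' (a := (0 : ℝ))
    (fun x _ => hasDerivAt_eval_mul_exp p x) hi
    (tendsto_zero_of_hasDerivAt_of_integrableOn_Ioi (a := (0 : ℝ))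
      (fun x _ => hasDerivAt_eval_mul_exp p x) hi (integrable_eval_mul_exp _).integrableOn)
  simpa using h

/-! ### Inner products on the half-line. -/

/-- The inner product of two monic Hermite polynomials over the positive half-line. -/
def halfInner (i j : ℕ) : ℝ :=
  ∫ x in Set.Ioi (0 : ℝ), (monicHermite i * monicHermite j).eval x * Real.exp (-x ^ 2)

theorem halfInner_comm (i j : ℕ) : halfInner i j = halfInner j i := by
  simp only [halfInner, mul_comm (monicHermite i)]

/-- The squared norm of the `n`-th monic Hermite polynomial. -/
def normSq (n : ℕ) : ℝ :=
  ∫ x : ℝ, (monicHermite n * monicHermite n).eval x * Real.exp (-x ^ 2)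

theorem normSq_zero : normSq 0 = √Real.pi := by
  have := integral_gaussian 1
  simpa [normSq, monicHermite] using this

/-- The derivative of $H_{n+1}H_ne^{-x^2}$ is $((n+1)H_n^2-2H_{n+1}^2)e^{-x^2}$, and it integrates
to zero. -/
theorem normSq_succ (n : ℕ) : normSq (n + 1) = (n + 1) / 2 * normSq n := by
  have h := integral_eval_deriv (monicHermite (n + 1) * monicHermite n)
  have hp : derivative (monicHermite (n + 1) * monicHermite n)
      - 2 * X * (monicHermite (n + 1) * monicHermite n)
      = C (n + 1 : ℝ) * (monicHermite n * monicHermite n)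
        - C 2 * (monicHermite (n + 1) * monicHermite (n + 1)) := by
    rw [derivative_mul, derivative_monicHermite_succ]
    have h2 : (2 : ℝ[X]) * C (1 / 2) = 1 := by
      rw [← C_ofNat, ← C_mul]; norm_num
    have h3 : monicHermite (n + 1)
      = X * monicHermite n - C (1 / 2) * derivative (monicHermite n) := rfl
    simp only [C_ofNat]
    linear_combination (2 * monicHermite (n + 1)) * h3
      - monicHermite (n + 1) * derivative (monicHermite n) * h2
  rw [hp] at h
  have h4 : ∀ x : ℝ, (C (n + 1 : ℝ) * (monicHermite n * monicHermite n)
        - C 2 * (monicHermite (n + 1) * monicHermite (n + 1))).eval x * Real.exp (-x ^ 2)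
      = (n + 1) * ((monicHermite n * monicHermite n).eval x * Real.exp (-x ^ 2))
        - 2 * ((monicHermite (n + 1) * monicHermite (n + 1)).eval x * Real.exp (-x ^ 2)) := by
    intro x
    simp only [eval_sub, eval_mul, eval_C]
    ring
  simp only [h4] at h
  rw [integral_sub ((integrable_eval_mul_exp _).const_mul _)
    ((integrable_eval_mul_exp _).const_mul _), integral_const_mul, integral_const_mul] at h
  simp only [normSq]
  linarith

theorem normSq_pos (n : ℕ) : 0 < normSq n := by
  induction n with
  | zero => rw [normSq_zero]; exact Real.sqrt_pos.2 Real.pi_pos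
  | succ n ih => rw [normSq_succ]; positivity

theorem integral_Iio_monicHermite (i j : ℕ) :
    ∫ x in Set.Iio (0 : ℝ), (monicHermite i * monicHermite j).eval x * Real.exp (-x ^ 2)
      = (-1) ^ (i + j) * halfInner i j := by
  have h := integral_comp_neg_Ioi (0 : ℝ)
    (fun x : ℝ => (monicHermite i * monicHermite j).eval x * Real.exp (-x ^ 2))
  rw [neg_zero, integral_Iic_eq_integral_Iio] at h
  rw [← h, halfInner, ← integral_const_mul]
  refine integral_congr_ae (.of_forall fun x => ?_)
  have hi := congrArg (eval x) (monicHermite_comp_neg i)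
  have hj := congrArg (eval x) (monicHermite_comp_neg j)
  simp only [eval_comp, eval_neg, eval_X, eval_mul, eval_pow, eval_one] at hi hj
  simp only [eval_mul, hi, hj, even_two.neg_pow, pow_add]
  ring

theorem integral_Iio_add_halfInner (i j : ℕ) :
    (∫ x in Set.Iio (0 : ℝ), (monicHermite i * monicHermite j).eval x * Real.exp (-x ^ 2))
      + halfInner i j = ∫ x : ℝ, (monicHermite i * monicHermite j).eval x * Real.exp (-x ^ 2) := by
  rw [← integral_Iic_eq_integral_Iio, halfInner]
  have := integral_add_compl (measurableSet_Iic (a := (0 : ℝ)))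
    (integrable_eval_mul_exp (monicHermite i * monicHermite j))
  rwa [Set.compl_Iic] at this

theorem halfInner_self (i : ℕ) : halfInner i i = normSq i / 2 := by
  have h1 := integral_Iio_add_halfInner i i
  rw [integral_Iio_monicHermite, Even.neg_one_pow ⟨i, rfl⟩, one_mul] at h1
  rw [normSq, ← h1]
  ring

/-- Sturm–Liouville argument: by the Hermite equation, the derivative of the Wronskian times
$e^{-x^2}$ is $2(i-j)H_iH_je^{-x^2}$, so only the boundary term at $0$ survives. -/
theorem sub_mul_halfInner (i j : ℕ) : 2 * ((i : ℝ) - j) * halfInner i j =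
    (derivative (monicHermite i)).eval 0 * (monicHermite j).eval 0
      - (monicHermite i).eval 0 * (derivative (monicHermite j)).eval 0 := by
  have h := integral_Ioi_eval_deriv (monicHermite i * derivative (monicHermite j)
    - derivative (monicHermite i) * monicHermite j)
  have hp : derivative (monicHermite i * derivative (monicHermite j)
      - derivative (monicHermite i) * monicHermite j)
      - 2 * X * (monicHermite i * derivative (monicHermite j)
      - derivative (monicHermite i) * monicHermite j)
      = C (2 * ((i : ℝ) - j)) * (monicHermite i * monicHermite j) := by
    rw [derivative_sub, derivative_mul, derivative_mul, monicHermite_ode, monicHermite_ode]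
    simp only [map_mul, map_sub, C_ofNat]
    ring
  rw [hp] at h
  simp only [eval_mul (p := C _), eval_C, mul_assoc, integral_const_mul] at h
  rw [mul_assoc, halfInner, h]
  simp only [eval_sub, eval_mul]
  ring

theorem monicHermite_eval_zero_succ_succ (n : ℕ) :
    (monicHermite (n + 2)).eval 0 = -(n + 1) / 2 * (monicHermite n).eval 0 := by
  rw [monicHermite, derivative_monicHermite_succ]
  simp
  ring

theorem monicHermite_eval_zero_odd (k : ℕ) : (monicHermite (2 * k + 1)).eval 0 = 0 := by
  induction k with
  | zero => simp [monicHermite]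
  | succ k ih =>
    rw [show 2 * (k + 1) + 1 = 2 * k + 1 + 2 by ring, monicHermite_eval_zero_succ_succ, ih, mul_zero]

theorem derivative_monicHermite_eval_zero_even (k : ℕ) :
    (derivative (monicHermite (2 * k))).eval 0 = 0 := by
  cases k with
  | zero => simp [monicHermite]
  | succ k =>
    rw [show 2 * (k + 1) = 2 * k + 1 + 1 by ring, derivative_monicHermite_succ]
    simp [monicHermite_eval_zero_odd]

theorem halfInner_eq_zero {i j : ℕ} (hij : i ≠ j) (h : Even (i + j)) : halfInner i j = 0 := by
  have hw := sub_mul_halfInner i j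
  have h0 : 2 * ((i : ℝ) - j) ≠ 0 :=
    mul_ne_zero two_ne_zero (sub_ne_zero.2 (Nat.cast_injective.ne hij))
  refine (mul_eq_zero.1 (hw.trans ?_)).resolve_left h0
  rcases Nat.even_or_odd' i with ⟨k, rfl | rfl⟩ <;> rcases Nat.even_or_odd' j with ⟨l, rfl | rfl⟩
  · simp [derivative_monicHermite_eval_zero_even]
  · exact absurd h (by simp [parity_simps])
  · exact absurd h (by simp [parity_simps])
  · simp [monicHermite_eval_zero_odd]

/-- For $i\ne j$ of equal parity both half-line integrals vanish; for opposite parity they cancel by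
reflection. -/
theorem integral_monicHermite_mul (i j : ℕ) :
    ∫ x : ℝ, (monicHermite i * monicHermite j).eval x * Real.exp (-x ^ 2)
      = if i = j then normSq i else 0 := by
  split_ifs with h
  · rw [normSq, h]
  · rw [← integral_Iio_add_halfInner, integral_Iio_monicHermite]
    rcases Nat.even_or_odd (i + j) with hp | hp
    · rw [halfInner_eq_zero h hp]; simp
    · rw [hp.neg_one_pow]; ring

/-! ### Overlaps in closed form and their column sums. -/

/-- The squared matrix elements of the projection onto the positive half-line, between
normalised Hermite functions. -/
def overlap (i j : ℕ) : ℝ := halfInner i j ^ 2 / (normSq i * normSq j)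

theorem overlap_comm (i j : ℕ) : overlap i j = overlap j i := by
  rw [overlap, overlap, halfInner_comm, mul_comm (normSq i)]

theorem overlap_self (i : ℕ) : overlap i i = 1 / 4 := by
  have := (normSq_pos i).ne'
  rw [overlap, halfInner_self]
  field_simp
  norm_num

theorem overlap_eq_zero {i j : ℕ} (hij : i ≠ j) (h : Even (i + j)) : overlap i j = 0 := by
  simp [overlap, halfInner_eq_zero hij h]

/-- The squared value at the origin of the normalised Hermite function of degree `2 k`. -/
def originSq (k : ℕ) : ℝ := (monicHermite (2 * k)).eval 0 ^ 2 / normSq (2 * k)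

theorem originSq_zero : originSq 0 = 1 / √Real.pi := by
  simp [originSq, normSq_zero, monicHermite]

theorem originSq_succ (k : ℕ) : originSq (k + 1) * (2 * k + 2) = originSq k * (2 * k + 1) := by
  have := (normSq_pos (2 * k)).ne'
  rw [originSq, originSq, show 2 * (k + 1) = 2 * k + 2 by ring, monicHermite_eval_zero_succ_succ,
    normSq_succ, normSq_succ]
  push_cast
  field_simp
  ring

/-- Parity leaves one term of the Wronskian at $0$, and $H_{2l+1}'(0)=(2l+1)H_{2l}(0)$ factors it
into values at the origin. -/
theorem overlap_even_odd (k l : ℕ) : overlap (2 * k) (2 * l + 1) =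
    originSq k * originSq l * (2 * l + 1) / (2 * (2 * k - 2 * l - 1) ^ 2) := by
  have h := sub_mul_halfInner (2 * k) (2 * l + 1)
  rw [derivative_monicHermite_eval_zero_even, derivative_monicHermite_succ] at h
  simp only [eval_mul, eval_C] at h
  push_cast at h
  have h0 : (2 * (k : ℝ) - 2 * l - 1) ≠ 0 := by
    intro h0
    have : (2 * (k : ℤ) - 2 * l - 1) = 0 := by exact_mod_cast h0
    omega
  have hB : halfInner (2 * k) (2 * l + 1) = -((monicHermite (2 * k)).eval 0 *
      ((2 * l + 1) * (monicHermite (2 * l)).eval 0)) / (2 * (2 * k - 2 * l - 1)) := by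
    rw [eq_div_iff (mul_ne_zero two_ne_zero h0)]
    linarith
  have h1 := (normSq_pos (2 * k)).ne'
  have h2 := (normSq_pos (2 * l)).ne'
  rw [overlap, hB, originSq, originSq, normSq_succ]
  push_cast
  have h3 : (2 * (l : ℝ) + 1) ≠ 0 := by positivity
  field_simp

/-- The squared norm of the `n`-th column above the diagonal. -/
def columnSum (n : ℕ) : ℝ := ∑ i ∈ Finset.range n, overlap i n

theorem sum_range_two_mul (f : ℕ → ℝ) (m : ℕ) :
    ∑ i ∈ Finset.range (2 * m), f i = ∑ k ∈ Finset.range m, (f (2 * k) + f (2 * k + 1)) := by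
  induction m with
  | zero => simp
  | succ m ih =>
    rw [show 2 * (m + 1) = 2 * m + 1 + 1 by ring, Finset.sum_range_succ, Finset.sum_range_succ, ih,
      Finset.sum_range_succ, add_assoc]

theorem columnSum_even (m : ℕ) :
    columnSum (2 * m) = ∑ l ∈ Finset.range m, overlap (2 * m) (2 * l + 1) := by
  rw [columnSum, sum_range_two_mul]
  refine Finset.sum_congr rfl fun l hl => ?_
  have := Finset.mem_range.1 hl
  rw [overlap_eq_zero (by omega) ⟨l + m, by ring⟩, zero_add, overlap_comm]

theorem columnSum_odd (m : ℕ) :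
    columnSum (2 * m + 1) = ∑ k ∈ Finset.range (m + 1), overlap (2 * k) (2 * m + 1) := by
  rw [columnSum, Finset.sum_range_succ, Finset.sum_range_succ, sum_range_two_mul]
  congr 1
  refine Finset.sum_congr rfl fun k hk => ?_
  have := Finset.mem_range.1 hk
  rw [overlap_eq_zero (i := 2 * k + 1) (by omega) ⟨k + m + 1, by ring⟩, add_zero]

/-- The first two column sums have terms with a common denominator, and their combination carries a
factor $2l$. This kills $l=0$; for the rest, `originSq_succ` and the shift $l\mapsto l+1$ turn the
terms into those of the third column sum. -/
theorem columnSum_recurrence (m : ℕ) :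
    (2 * m + 2) * columnSum (2 * m + 2) - columnSum (2 * m + 1)
      - (2 * m + 1) * columnSum (2 * m) = 0 := by
  rw [show 2 * m + 2 = 2 * (m + 1) by ring, columnSum_even, columnSum_odd, columnSum_even,
    Finset.mul_sum, Finset.mul_sum, ← Finset.sum_sub_distrib, Finset.sum_range_succ', sub_eq_zero]
  have key : ∀ l : ℕ, (2 * (m : ℝ) + 2) * overlap (2 * (m + 1)) (2 * l + 1)
      - overlap (2 * l) (2 * m + 1) = (2 * m + 1) * originSq m * (originSq l * (2 * l))
        / (2 * (2 * l - 2 * m - 1) ^ 2) := by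
    intro l
    have h1 := originSq_succ m
    rw [overlap_even_odd, overlap_even_odd]
    have h2 : (2 * ((m + 1 : ℕ) : ℝ) - 2 * l - 1) ^ 2 = (2 * l - 2 * m - 1) ^ 2 := by
      push_cast; ring
    rw [h2]
    rw [← mul_div_assoc, ← sub_div]
    congr 1
    linear_combination originSq l * (2 * l + 1) * h1
  simp only [key]
  simp only [Nat.cast_zero, mul_zero, zero_div, add_zero]
  refine Finset.sum_congr rfl fun l _ => ?_
  have h1 := originSq_succ l
  rw [overlap_even_odd, ← mul_div_assoc]
  have h2 : (2 * ((l + 1 : ℕ) : ℝ) - 2 * m - 1) ^ 2 = (2 * m - 2 * l - 1) ^ 2 := by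
    push_cast; ring
  rw [h2]
  congr 1
  push_cast
  linear_combination (2 * m + 1) * originSq m * h1

theorem columnSum_one : columnSum 1 = 1 / (2 * Real.pi) := by
  have h := columnSum_odd 0
  have h2 := overlap_even_odd 0 0
  simp only [mul_zero, zero_add, Finset.sum_range_one] at h h2
  rw [h, h2, originSq_zero, div_mul_div_comm, Real.mul_self_sqrt Real.pi_pos.le]
  have := Real.pi_pos.ne'
  simp
  field_simp

/-- The squared Hilbert-Schmidt norm of the compression to the first `n` Hermite functions of the
projection onto the positive half-line. -/
def overlapSum (n : ℕ) : ℝ := ∑ i ∈ Finset.range n, ∑ j ∈ Finset.range n, overlap i j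

theorem overlapSum_succ (n : ℕ) : overlapSum (n + 1) = overlapSum n + 2 * columnSum n + 1 / 4 := by
  simp only [overlapSum, Finset.sum_range_succ, Finset.sum_add_distrib, overlap_self, columnSum,
    overlap_comm n]
  ring

/-! ### The generating function of the index as a determinant. -/

/-- The Gaussian weight, multiplied by `ξ` on the positive half-line. -/
def stepWeight (ξ x : ℝ) : ℝ := (if 0 < x then ξ else 1) * Real.exp (-x ^ 2)

theorem integrable_stepWeight_mul (ξ : ℝ) (p : ℝ[X]) :
    Integrable fun x => stepWeight ξ x * p.eval x := by
  have h : Measurable fun x : ℝ => if 0 < x then ξ else 1 :=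
    Measurable.ite measurableSet_Ioi measurable_const measurable_const
  have := (integrable_eval_mul_exp p).bdd_mul (c := max |ξ| 1) h.aestronglyMeasurable
    (.of_forall fun x => by
      rw [Real.norm_eq_abs]
      split_ifs <;> simp)
  refine this.congr (.of_forall fun x => ?_)
  simp only [stepWeight]
  ring

theorem integral_stepWeight_mul (ξ : ℝ) (p : ℝ[X]) :
    ∫ x, stepWeight ξ x * p.eval x =
      (∫ x in Set.Iio (0 : ℝ), p.eval x * Real.exp (-x ^ 2))
        + ξ * ∫ x in Set.Ioi (0 : ℝ), p.eval x * Real.exp (-x ^ 2) := by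
  rw [← integral_add_compl (measurableSet_Iic (a := (0 : ℝ))) (integrable_stepWeight_mul ξ p),
    Set.compl_Iic, ← integral_const_mul, ← integral_Iic_eq_integral_Iio]
  congr 1
  · refine setIntegral_congr_fun measurableSet_Iic fun x hx => ?_
    simp only [stepWeight, if_neg (not_lt.2 (Set.mem_Iic.1 hx))]
    ring
  · refine setIntegral_congr_fun measurableSet_Ioi fun x hx => ?_
    simp only [stepWeight, if_pos (Set.mem_Ioi.1 hx)]
    ring

theorem weight_eq_det_vandermonde (n : ℕ) (l : Fin n → ℝ) :
    weight n l = Real.exp (-∑ j, l j ^ 2) * (Matrix.vandermonde l).det ^ 2 := by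
  simp only [weight, Matrix.det_vandermonde, ← Finset.prod_pow]
  congr 1
  exact Finset.prod_congr rfl fun i _ => Finset.prod_congr rfl fun j _ => by ring

theorem prod_stepWeight (n : ℕ) (ξ : ℝ) (l : Fin n → ℝ) :
    ∏ i, stepWeight ξ (l i) = ξ ^ index l * Real.exp (-∑ j, l j ^ 2) := by
  simp only [stepWeight, Finset.prod_mul_distrib, Finset.prod_ite, Finset.prod_const, one_pow,
    mul_one, index, ← Finset.sum_neg_distrib, Real.exp_sum]

/-- Any monic basis produces the Vandermonde determinant. Monomials lead to `tau`, Hermite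
polynomials to `indexGen`. -/
theorem integral_pow_index_mul_weight (n : ℕ) (ξ : ℝ) (p : Fin n → ℝ[X])
    (hd : ∀ i, (p i).natDegree = i) (hm : ∀ i, (p i).Monic) :
    Integrable (fun l : Fin n → ℝ => ξ ^ index l * weight n l) ∧
    ∫ l : Fin n → ℝ, ξ ^ index l * weight n l = n.factorial * (Matrix.of fun i j =>
      (∫ x in Set.Iio (0 : ℝ), (p i * p j).eval x * Real.exp (-x ^ 2))
        + ξ * ∫ x in Set.Ioi (0 : ℝ), (p i * p j).eval x * Real.exp (-x ^ 2)).det := by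
  have h := integral_prod_mul_det_sq (stepWeight ξ) (fun i x => (p i).eval x)
    (fun i j => by simpa only [eval_mul] using integrable_stepWeight_mul ξ (p i * p j))
  simp only [← Matrix.det_eval_matrixOfPolynomials_eq_det_vandermonde _ p hd hm, prod_stepWeight,
    mul_assoc, ← weight_eq_det_vandermonde, ← eval_mul, integral_stepWeight_mul] at h
  exact h

theorem factorial_mul_tau (n : ℕ) (ξ : ℝ) :
    n.factorial * tau n ξ = 2 ^ (n * (n - 1)) * ∫ l : Fin n → ℝ, ξ ^ index l * weight n l := by
  rw [(integral_pow_index_mul_weight n ξ (fun i => X ^ (i : ℕ)) (by simp)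
    fun i => monic_X_pow _).2, tau]
  set M := Matrix.of fun i j : Fin n =>
      (∫ x in Set.Iio (0 : ℝ), (X ^ (i : ℕ) * X ^ (j : ℕ) : ℝ[X]).eval x * Real.exp (-x ^ 2))
        + ξ * ∫ x in Set.Ioi (0 : ℝ),
          (X ^ (i : ℕ) * X ^ (j : ℕ) : ℝ[X]).eval x * Real.exp (-x ^ 2) with hM
  -- The signs $(-1)^{i+j}$ coming from $(-x)^{i+j}$ scale rows and columns alike, so they leave the
  -- determinant unchanged.
  have h1 := Matrix.det_mul_column (fun i : Fin n => (-1 : ℝ) ^ (i : ℕ)) M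
  have h2 := Matrix.det_mul_row (fun i : Fin n => (-1 : ℝ) ^ (i : ℕ))
    (Matrix.of fun i j => (-1 : ℝ) ^ (i : ℕ) * M i j)
  rw [h1, ← mul_assoc, ← Finset.prod_mul_distrib] at h2
  simp only [← mul_pow, mul_neg, mul_one, neg_neg, one_pow, Finset.prod_const_one, one_mul] at h2
  rw [← h2]
  have h3 : (Matrix.of fun i j : Fin n =>
      (∫ x in Set.Iio (0 : ℝ), (-x) ^ (i.val + j.val) * Real.exp (-x ^ 2))
        + ξ * ∫ x in Set.Ioi (0 : ℝ), (-x) ^ (i.val + j.val) * Real.exp (-x ^ 2)) =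
      Matrix.of fun i j : Fin n => (-1 : ℝ) ^ (j : ℕ) *
        (Matrix.of fun i j : Fin n => (-1 : ℝ) ^ (i : ℕ) * M i j) i j := by
    ext i j
    have h4 : ∀ x : ℝ, (-x) ^ (i.val + j.val) * Real.exp (-x ^ 2) = ((-1) ^ (j : ℕ) * (-1) ^ (i : ℕ))
        * ((X ^ (i : ℕ) * X ^ (j : ℕ) : ℝ[X]).eval x * Real.exp (-x ^ 2)) := by
      intro x
      simp only [eval_mul, eval_pow, eval_X]
      rw [neg_pow, pow_add, pow_add]
      ring
    simp only [Matrix.of_apply, hM, h4, integral_const_mul]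
    ring
  rw [h3]
  ring

/-- The compression to the first `n` normalised Hermite functions of the projection onto the
positive half-line. -/
def halfMatrix (n : ℕ) : Matrix (Fin n) (Fin n) ℝ :=
  Matrix.of fun i j => halfInner i j / (√(normSq i) * √(normSq j))

theorem halfMatrix_isHermitian (n : ℕ) : (halfMatrix n).IsHermitian := by
  ext i j
  simp [halfMatrix, halfInner_comm (j : ℕ), mul_comm (√(normSq j))]

theorem trace_halfMatrix (n : ℕ) : (halfMatrix n).trace = n / 2 := by
  have : ∀ i : Fin n, halfMatrix n i i = 1 / 2 := by
    intro i
    have := (normSq_pos i).ne'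
    rw [halfMatrix, Matrix.of_apply, halfInner_self, Real.mul_self_sqrt (normSq_pos i).le]
    field_simp
  simp [Matrix.trace, this, div_eq_mul_inv]

theorem trace_halfMatrix_mul_self (n : ℕ) : (halfMatrix n * halfMatrix n).trace = overlapSum n := by
  rw [overlapSum, ← Fin.sum_univ_eq_sum_range (fun i => ∑ j ∈ Finset.range n, overlap i j)]
  refine Finset.sum_congr rfl fun i _ => ?_
  rw [Matrix.diag_apply, Matrix.mul_apply, ← Fin.sum_univ_eq_sum_range (fun j => overlap i j)]
  refine Finset.sum_congr rfl fun j _ => ?_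
  rw [halfMatrix, Matrix.of_apply, Matrix.of_apply, halfInner_comm j, div_mul_div_comm, overlap,
    mul_comm (√(normSq j)), mul_mul_mul_comm, Real.mul_self_sqrt (normSq_pos i).le,
    Real.mul_self_sqrt (normSq_pos j).le, sq]

/-- The probability generating function of the index. -/
def indexGen (n : ℕ) (ξ : ℝ) : ℝ := (1 + (ξ - 1) • halfMatrix n).det

theorem indexGen_hasJet (n : ℕ) :
    HasJet (indexGen n) 1 1 (n / 2) ((n / 2) ^ 2 - overlapSum n) := by
  have h := det_one_add_smul_hasJet (halfMatrix n) (halfMatrix_isHermitian n)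
  rwa [trace_halfMatrix, trace_halfMatrix_mul_self] at h

theorem integral_pow_index (n : ℕ) (ξ : ℝ) : ∫ l : Fin n → ℝ, ξ ^ index l * weight n l =
    n.factorial * (∏ i ∈ Finset.range n, normSq i) * indexGen n ξ := by
  rw [(integral_pow_index_mul_weight n ξ (fun i => monicHermite i)
    (fun i => (monicHermite_natDegree_monic i).1) fun i => (monicHermite_natDegree_monic i).2).2,
    mul_assoc]
  congr 1
  -- Scaling rows and columns by the norms passes from normalised to monic Hermite polynomials and
  -- produces the product of the `normSq i`.
  set s : Fin n → ℝ := fun i => √(normSq i) with hs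
  have hs0 : ∀ i, s i ≠ 0 := fun i => (Real.sqrt_pos.2 (normSq_pos i)).ne'
  have hss : ∀ i, s i * s i = normSq i := fun i => Real.mul_self_sqrt (normSq_pos i).le
  have h1 := Matrix.det_mul_column s (1 + (ξ - 1) • halfMatrix n)
  have h2 := Matrix.det_mul_row s (Matrix.of fun i j => s i * (1 + (ξ - 1) • halfMatrix n) i j)
  rw [h1, ← mul_assoc, ← Finset.prod_mul_distrib] at h2
  simp only [hss] at h2
  rw [← Fin.prod_univ_eq_prod_range, indexGen, ← h2]
  congr 1
  ext i j
  have h3 := integral_Iio_add_halfInner i j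
  rw [integral_monicHermite_mul, ← eq_sub_iff_add_eq] at h3
  rw [Matrix.of_apply, h3, ← halfInner]
  have := hs0 i
  have := hs0 j
  have h4 : halfMatrix n i j = halfInner i j / (s i * s j) := rfl
  simp only [Matrix.of_apply, Matrix.add_apply, Matrix.smul_apply, smul_eq_mul, h4]
  by_cases hij : i = j
  · subst hij
    rw [Matrix.one_apply_eq, if_pos rfl]
    rw [← hss]
    field_simp
    ring
  · rw [Matrix.one_apply_ne hij, if_neg (fun h => hij (Fin.ext h))]
    field_simp
    ring

theorem prod_normSq_pos (n : ℕ) : 0 < ∏ i ∈ Finset.range n, normSq i :=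
  Finset.prod_pos fun i _ => normSq_pos i

theorem indexGen_one (n : ℕ) : indexGen n 1 = 1 := (indexGen_hasJet n).deriv_deriv_eq.1

theorem normalisation_eq (n : ℕ) :
    normalisation n = n.factorial * ∏ i ∈ Finset.range n, normSq i := by
  simpa [indexGen_one, normalisation] using integral_pow_index n 1

theorem tau_eq (n : ℕ) (ξ : ℝ) :
    tau n ξ = 2 ^ (n * (n - 1)) * (∏ i ∈ Finset.range n, normSq i) * indexGen n ξ := by
  have h0 : (n.factorial : ℝ) ≠ 0 := by positivity
  refine mul_left_cancel₀ h0 ?_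
  rw [factorial_mul_tau, integral_pow_index]
  ring

theorem measurable_index (n : ℕ) : Measurable (index : (Fin n → ℝ) → ℕ) := by
  have : (index : (Fin n → ℝ) → ℕ) = fun l => ∑ i, if 0 < l i then 1 else 0 :=
    funext fun l => Finset.card_filter _ _
  rw [this]
  refine Finset.measurable_sum _ fun i _ => Measurable.ite ?_ measurable_const measurable_const
  exact measurableSet_lt measurable_const (measurable_pi_apply i)

theorem integrable_weight (n : ℕ) : Integrable (weight n) := by
  simpa using (integral_pow_index_mul_weight n 1 (fun i => monicHermite i)
    (fun i => (monicHermite_natDegree_monic i).1) fun i => (monicHermite_natDegree_monic i).2).1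

theorem sum_prob_mul_pow (n : ℕ) (ξ : ℝ) :
    ∑ k ∈ Finset.range (n + 1), prob n k * ξ ^ k = indexGen n ξ := by
  have hN : normalisation n ≠ 0 := by
    rw [normalisation_eq]
    have := prod_normSq_pos n
    positivity
  have hs : ∀ k, MeasurableSet {l : Fin n → ℝ | index l = k} := fun k =>
    measurable_index n (measurableSet_singleton k)
  have hpt : ∀ l : Fin n → ℝ, ξ ^ index l * weight n l = ∑ k ∈ Finset.range (n + 1),
      ξ ^ k * {l : Fin n → ℝ | index l = k}.indicator (weight n) l := by
    intro l
    have hl : index l ∈ Finset.range (n + 1) := Finset.mem_range_succ_iff.2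
      ((Finset.card_le_univ _).trans_eq (Fintype.card_fin n))
    rw [Finset.sum_eq_single_of_mem _ hl, Set.indicator_of_mem]
    · rfl
    · intro k _ hk
      rw [Set.indicator_of_notMem, mul_zero]
      exact fun h => hk h.symm
  have h : ∫ l : Fin n → ℝ, ξ ^ index l * weight n l =
      ∑ k ∈ Finset.range (n + 1), ξ ^ k * ∫ l in {l : Fin n → ℝ | index l = k}, weight n l := by
    simp only [hpt]
    rw [integral_finsetSum _ fun k _ => ((integrable_weight n).indicator (hs k)).const_mul _]
    simp only [integral_const_mul, integral_indicator (hs _)]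
  rw [integral_pow_index, ← normalisation_eq] at h
  rw [← mul_right_inj' hN, h, Finset.mul_sum]
  refine Finset.sum_congr rfl fun k _ => ?_
  rw [prob]
  field_simp

/-- The jet of the generating function at $1$ consists of total mass, mean and second factorial
moment; these are matched with the jet of the determinant. -/
theorem Delta_eq (n : ℕ) : Delta n = n / 2 - overlapSum n := by
  have h1 : HasJet (indexGen n) 1 (∑ k ∈ Finset.range (n + 1), prob n k)
      (∑ k ∈ Finset.range (n + 1), prob n k * k)
      (∑ k ∈ Finset.range (n + 1), prob n k * (k * (k - 1))) := by
    rw [← funext (sum_prob_mul_pow n)]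
    refine HasJet.sum _ fun k _ => ?_
    exact ((HasJet.const 1 (prob n k)).mul (HasJet.pow_at_one k)).congr_jet (by ring) (by ring)
      (by ring)
  obtain ⟨h2, h3, h4⟩ := h1.unique (indexGen_hasJet n)
  have hm : mean n = n / 2 := by
    rw [← h3, mean]
    exact Finset.sum_congr rfl fun k _ => mul_comm _ _
  have h5 : ∀ k : ℕ, ((k : ℝ) - mean n) ^ 2 * prob n k = prob n k * (k * (k - 1))
      + (1 - 2 * mean n) * (prob n k * k) + mean n ^ 2 * prob n k := fun k => by ring
  rw [Delta, Finset.sum_congr rfl fun k _ => h5 k]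
  simp only [Finset.sum_add_distrib, ← Finset.mul_sum, h2, h3, h4, hm]
  ring

/-! ### The difference equation. -/

theorem Delta_succ (n : ℕ) : Delta (n + 1) = Delta n + 1 / 4 - 2 * columnSum n := by
  rw [Delta_eq, Delta_eq, overlapSum_succ]
  push_cast
  ring

/-- The factor $2(n+1)$ is $4$, from the powers of two, times `normSq (n + 1) / normSq n`
$=(n+1)/2$. -/
theorem g_succ_eq (n : ℕ) (ξ : ℝ) : g (n + 1) ξ = 2 * (n + 1) *
    (indexGen (n + 2) ξ * indexGen n ξ * (indexGen (n + 1) ξ * indexGen (n + 1) ξ)⁻¹)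
      - 2 * (n + 1) := by
  rw [g, tau_eq, tau_eq, tau_eq, Finset.prod_range_succ _ (n + 1), Finset.prod_range_succ,
    normSq_succ]
  congr 1
  have h1 := (prod_normSq_pos n).ne'
  have h2 := (normSq_pos n).ne'
  have h3 : (2 : ℝ) ^ ((n + 2) * (n + 2 - 1)) * 2 ^ (n * (n - 1))
      = 4 * (2 ^ ((n + 1) * (n + 1 - 1))) ^ 2 := by
    rw [← pow_add, ← pow_mul, show (4 : ℝ) = 2 ^ 2 by norm_num, ← pow_add]
    congr 1
    cases n with
    | zero => rfl
    | succ n => simp only [Nat.add_sub_cancel, Nat.add_succ_sub_one]; ring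
  have hc : (2 : ℝ) ^ ((n + 1) * (n + 1 - 1)) ≠ 0 := by positivity
  generalize (2 : ℝ) ^ ((n + 2) * (n + 2 - 1)) = a at *
  generalize (2 : ℝ) ^ (n * (n - 1)) = b at *
  generalize (2 : ℝ) ^ ((n + 1) * (n + 1 - 1)) = c at *
  -- At zeros of the denominator both quotients take the default value $0$.
  rcases eq_or_ne (indexGen (n + 1) ξ) 0 with h0 | h0
  · simp [h0]
  · field_simp
    linear_combination indexGen (n + 2) ξ * indexGen n ξ * h3

/-- The ratio has value $1$ and first derivative $\frac{n+2}2+\frac n2-(n+1)=0$ at $1$, so its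
second derivative is that of its logarithm: the second difference of $-\operatorname{tr}A_n^2$,
which equals that of $\Delta$ since $n/2$ is linear. -/
theorem iteratedDeriv_g (n : ℕ) : iteratedDeriv 2 (g (n + 1)) 1 =
    2 * (n + 1) * (Delta (n + 2) - 2 * Delta (n + 1) + Delta n) := by
  have h1 := indexGen_hasJet (n + 1)
  have h := ((HasJet.const 1 (2 * (n + 1 : ℝ))).mul (((indexGen_hasJet (n + 2)).mul
    (indexGen_hasJet n)).mul ((h1.mul h1).inv (by norm_num)))).add (HasJet.const 1 (-(2 * (n + 1 : ℝ))))
  simp only [← sub_eq_add_neg, ← g_succ_eq] at h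
  rw [h.iteratedDeriv_two, Delta_eq, Delta_eq, Delta_eq]
  push_cast
  ring

theorem e_eq (n : ℕ) : e (n + 2) = (n + 1) * (Delta (n + 2) - 2 * Delta (n + 1) + Delta n)
    + (n + 2) * (Delta (n + 3) - 2 * Delta (n + 2) + Delta (n + 1)) := by
  rw [e, show n + 2 - 1 = n + 1 by omega, iteratedDeriv_g, iteratedDeriv_g]
  push_cast
  ring

theorem Delta_isSolution : IsSolution Delta := by
  have h0 : Delta 0 = 0 := by simp [Delta_eq, overlapSum]
  have h1 : Delta 1 = 1 / 4 := by simp [Delta_succ, h0, columnSum]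
  refine ⟨h0, h1, ?_, fun n hn => ?_⟩
  · rw [Delta_succ, h1, columnSum_one]
    ring
  · obtain ⟨m, rfl | rfl⟩ := Nat.even_or_odd' n
    · obtain ⟨m, rfl⟩ : ∃ k, m = k + 1 := ⟨m - 1, by omega⟩
      rw [(even_two_mul _).neg_one_pow, show 2 * (m + 1) - 1 = 2 * m + 1 by omega,
        show 2 * (m + 1) - 2 = 2 * m by omega, show 2 * (m + 1) = 2 * m + 1 + 1 by ring,
        Delta_succ (2 * m + 1 + 1), Delta_succ (2 * m + 1), Delta_succ (2 * m)]
      have := columnSum_recurrence m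
      push_cast
      linear_combination (-2) * this
    -- For odd $n$ the left side regroups into the two second differences that make up $e_n$.
    · obtain ⟨m, rfl⟩ : ∃ k, m = k + 1 := ⟨m - 1, by omega⟩
      rw [(odd_two_mul_add_one _).neg_one_pow, show 2 * (m + 1) + 1 = 2 * m + 1 + 2 by ring, e_eq,
        show 2 * m + 1 + 2 - 1 = 2 * m + 1 + 1 by omega, Nat.add_sub_cancel]
      push_cast
      ring

/-! ### Two summations of the difference equation. -/

/-- The quantity $E_n=nD_{n+1}-(n+1)D_n$ changes only through the source under $n\mapsto n+2$, so
the parities decouple, with $E_0=0$ and $E_1=-1/\pi$ from the initial values. -/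
theorem IsSolution.first_integral {D : ℕ → ℝ} (h : IsSolution D) (m : ℕ) :
    (2 * m) * D (2 * m + 1) - (2 * m + 1) * D (2 * m) = 0 ∧
    (2 * m + 1) * D (2 * m + 2) - (2 * m + 2) * D (2 * m + 1)
      = (∑ l ∈ Finset.Icc 1 m, e (2 * l + 1)) - 1 / Real.pi := by
  obtain ⟨h0, h1, h2, h3⟩ := h
  induction m with
  | zero =>
    simp [h0, h1, h2]
    ring
  | succ m ih =>
    have ha := h3 (2 * m + 2) (by omega)
    have hb := h3 (2 * m + 3) (by omega)
    rw [show 2 * m + 2 - 1 = 2 * m + 1 by omega, show 2 * m + 2 - 2 = 2 * m by omega,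
      Even.neg_one_pow ⟨m + 1, by ring⟩] at ha
    rw [show 2 * m + 3 - 1 = 2 * m + 2 by omega, show 2 * m + 3 - 2 = 2 * m + 1 by omega,
      Odd.neg_one_pow ⟨m + 1, by ring⟩] at hb
    rw [Finset.sum_Icc_succ_top (by omega), show 2 * (m + 1) + 2 = 2 * m + 3 + 1 by ring,
      show 2 * (m + 1) + 1 = 2 * m + 3 by ring, show 2 * (m + 1) = 2 * m + 2 by ring]
    push_cast at ha hb ⊢
    exact ⟨by linear_combination ha + ih.1, by linear_combination hb + ih.2⟩

/-- After division by $(n+1)(n+2)$ the left side is a difference of consecutive values of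
`quadrature k / k`, which isolates the summand $j=n+1$. -/
theorem quadrature_succ_succ (n : ℕ) :
    (n + 1) * quadrature (n + 2) - (n + 2) * quadrature (n + 1) = (1 - (-1) ^ (n + 1)) / 2
      * ((∑ l ∈ Finset.Icc 1 (n / 2), e (2 * l + 1)) - 1 / Real.pi) := by
  rw [quadrature, quadrature, show n + 2 - 1 = n + 1 by omega, Nat.add_sub_cancel,
    Finset.sum_Icc_succ_top (by omega), Nat.add_sub_cancel]
  push_cast
  field_simp
  ring_nf

theorem IsSolution.eq_quadrature {D : ℕ → ℝ} (h : IsSolution D) (n : ℕ) : D n = quadrature n := by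
  match n with
  | 0 => simp [h.1, quadrature]
  | n + 1 =>
    induction n with
    | zero => simp [h.2.1, quadrature]
    | succ n ih =>
      have hq := quadrature_succ_succ n
      rw [← ih] at hq
      have hn : (n + 1 : ℝ) ≠ 0 := by positivity
      refine mul_left_cancel₀ hn ?_
      -- The relevant quantity is $E_{n+1}$: for even $n$ it is the odd first integral, for odd $n$
      -- the vanishing one.
      obtain ⟨m, rfl | rfl⟩ := Nat.even_or_odd' n
      · have := (h.first_integral m).2
        rw [Odd.neg_one_pow ⟨m, rfl⟩, Nat.mul_div_cancel_left _ two_pos, ← this] at hq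
        push_cast at hq ⊢
        linear_combination -hq
      · have := (h.first_integral (m + 1)).1
        rw [Even.neg_one_pow ⟨m + 1, by ring⟩] at hq
        rw [show 2 * (m + 1) = 2 * m + 1 + 1 by ring] at this
        push_cast at hq this ⊢
        linear_combination this - hq

end GUEIndex

end

theorem mainTheorem8 :
    (∀ n : ℕ, GUEIndex.Delta n = GUEIndex.quadrature n) ∧
    GUEIndex.IsSolution GUEIndex.Delta ∧
    (∀ D : ℕ → ℝ, GUEIndex.IsSolution D → ∀ n : ℕ, D n = GUEIndex.quadrature n) :=
  ⟨GUEIndex.Delta_isSolution.eq_quadrature, GUEIndex.Delta_isSolution,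
    fun _ h => h.eq_quadrature⟩
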